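/- All topological groups are Hausdorff and all topological vector spaces are real and Hausdorff. A topological vector space is called Fréchet if it is metrizable, complete and locally convex, and locally bounded if $0$ has a bounded neighbourhood. Let $X$ be an abelian topological group and let $\pi : X \to Z$ be an open continuous homomorphism of $X$ onto a topological vector space $Z$. Suppose that $\ker\pi$, with the addition and topology inherited from $X$, carries a scalar multiplication $\mathbb{R}\times\ker\pi\to\ker\pi$ that makes it a topological vector space. (i) If $\ker\pi$ is a Fréchet space and $Z$ is metrizable, then there is a scalar multiplication $\mathbb{R}\times X\to X$ which, together with the given addition and topology of $X$, makes $X$ a metrizable topological vector space, and for which $\pi$ and the inclusion $\ker\pi\hookrightarrow X$ are linear. (ii) If $\ker\pi$ is a complete locally bounded topological vector space and $Z$ is locally bounded, then there is a scalar multiplication $\mathbb{R}\times X\to X$ which, together with the given addition and topology of $X$, makes $X$ a locally bounded topological vector space, and for which $\pi$ and the inclusion $\ker\pi\hookrightarrow X$ are linear. -/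

import Mathlib

open Topology

/-- A commutative topological group is complete if it is complete for the uniformity whose
entourages are generated by the sets `{(x, y) | y - x ∈ U}`, with `U` a neighbourhood of `0`. -/
def IsCompleteAddGroup (G : Type*) [AddCommGroup G] [TopologicalSpace G]
    [IsTopologicalAddGroup G] : Prop :=
  @CompleteSpace G (IsTopologicalAddGroup.rightUniformSpace G)

/-- The given vector space operations and topology make `E` a Hausdorff topological vector
space over `ℝ`. -/
structure IsTVS (E : Type*) [AddCommGroup E] [Module ℝ E] [TopologicalSpace E] : Prop where
  isTopologicalAddGroup : IsTopologicalAddGroup E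
  continuousSMul : ContinuousSMul ℝ E
  t2Space : T2Space E

/-- A Fréchet space: a metrizable, complete, locally convex topological vector space. -/
structure IsFrechetTVS (E : Type*) [AddCommGroup E] [Module ℝ E] [TopologicalSpace E]
    [IsTopologicalAddGroup E] : Prop where
  isTVS : IsTVS E
  metrizable : TopologicalSpace.MetrizableSpace E
  complete : IsCompleteAddGroup E
  locallyConvex : LocallyConvexSpace ℝ E

/-- A locally bounded topological vector space: some neighbourhood of `0` is bounded, i.e.
absorbed by every neighbourhood of `0`. -/
structure IsLocallyBoundedTVS (E : Type*) [AddCommGroup E] [Module ℝ E] [TopologicalSpace E] :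
    Prop where
  isTVS : IsTVS E
  exists_bounded_nhds : ∃ U ∈ 𝓝 (0 : E), Bornology.IsVonNBounded ℝ U

/-- For a group homomorphism `π : X →+ Z` into a real vector space, whose kernel carries a real
vector space structure, a real vector space structure on `X` is compatible with these if the
inclusion of the kernel and `π` are both linear. -/
structure IsCompatibleModule {X Z : Type*} [AddCommGroup X] [AddCommGroup Z] [Module ℝ Z]
    (π : X →+ Z) [Module ℝ π.ker] [Module ℝ X] : Prop where
  incl_smul : ∀ (r : ℝ) (y : π.ker), ((r • y : π.ker) : X) = r • (y : X)
  map_smul : ∀ (r : ℝ) (x : X), π (r • x) = r • π x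

/-! `X` is uniquely divisible, so `N`-adic multiples of each `x` exist; the scalar multiplication is
their continuous extension to real `t`. The difficulty is to show that `k N⁻ʲ x` is small when `k
N⁻ʲ` is.

If arbitrarily small neighbourhoods `K` of `0` in the kernel satisfy `N⁻¹K + K' ⊆ K` for some
neighbourhood `K'`, the errors of a nonlinear section of `π` stay in `K` under repeated division by
`N` (`exists_small_lift`). Convexity gives this with `N = 2`, local boundedness with `N` large. The
multiples `⌊Nʲt⌋ N⁻ʲ x` are then Cauchy, and converge because their images do and the kernel is
complete (`exists_oneParameter`). The resulting one-parameter subgroups are unique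
(`oneParameter_ext`), which yields the module axioms. Metrizability and local boundedness pass from
kernel and quotient to `X`. -/

/-! ### Unique divisibility of the extension -/

/-- Multiplication by `n ≠ 0` is bijective on an extension of a real vector space by a real
vector space. -/
theorem nsmul_bijective_of_ker {X Z : Type*} [AddCommGroup X] [AddCommGroup Z] [Module ℝ Z]
    (π : X →+ Z) (hsurj : Function.Surjective π) [Module ℝ π.ker] {N : ℕ} (hN : N ≠ 0) :
    Function.Bijective (fun x : X => N • x) := by
  have hN' : (N : ℝ) ≠ 0 := by exact_mod_cast hN
  constructor
  · intro a b hab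
    have h1 : N • (a - b) = 0 := by rw [nsmul_sub, sub_eq_zero]; exact hab
    have h2 : π (a - b) = 0 := by
      have h3 : (N : ℝ) • π (a - b) = 0 := by
        rw [Nat.cast_smul_eq_nsmul, ← map_nsmul, h1, map_zero]
      exact (smul_eq_zero.1 h3).resolve_left hN'
    have h3 : (⟨a - b, h2⟩ : π.ker) = 0 := by
      have h4 : (N : ℝ) • (⟨a - b, h2⟩ : π.ker) = 0 := by
        rw [Nat.cast_smul_eq_nsmul]
        exact Subtype.ext h1
      exact (smul_eq_zero.1 h4).resolve_left hN'
    exact sub_eq_zero.1 (congrArg Subtype.val h3)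
  · intro x
    obtain ⟨x₁, hx₁⟩ := hsurj ((N : ℝ)⁻¹ • π x)
    have h1 : π (x - N • x₁) = 0 := by
      rw [map_sub, map_nsmul, hx₁, ← Nat.cast_smul_eq_nsmul ℝ, smul_inv_smul₀ hN', sub_self]
    refine ⟨x₁ + ((N : ℝ)⁻¹ • (⟨x - N • x₁, h1⟩ : π.ker) : π.ker), ?_⟩
    have h2 : N • ((N : ℝ)⁻¹ • (⟨x - N • x₁, h1⟩ : π.ker)) = ⟨x - N • x₁, h1⟩ := by
      rw [← Nat.cast_smul_eq_nsmul ℝ, smul_inv_smul₀ hN']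
    have h3 := congrArg Subtype.val h2
    simp only [AddSubgroup.coe_nsmul] at h3
    simp only [nsmul_add, h3]
    abel

/-- `h` is division by `N` in the additive group `X`. -/
structure IsDivision {X : Type*} [AddCommGroup X] (N : ℕ) (h : AddMonoid.End X) : Prop where
  nsmul_apply : ∀ x, N • h x = x
  apply_nsmul : ∀ x, h (N • x) = x

theorem exists_isDivision {X Z : Type*} [AddCommGroup X] [AddCommGroup Z] [Module ℝ Z]
    (π : X →+ Z) (hsurj : Function.Surjective π) [Module ℝ π.ker] {N : ℕ} (hN : N ≠ 0) :
    ∃ h : AddMonoid.End X, IsDivision N h := by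
  let e : X ≃+ X := AddEquiv.ofBijective (nsmulAddMonoidHom N)
    (nsmul_bijective_of_ker π hsurj hN)
  exact ⟨e.symm.toAddMonoidHom, fun x => e.apply_symm_apply x, fun x => e.symm_apply_apply x⟩

namespace IsDivision

variable {X Z : Type*} [AddCommGroup X] [AddCommGroup Z] [Module ℝ Z]
  {π : X →+ Z} [Module ℝ π.ker] {N : ℕ} {h : AddMonoid.End X}

theorem pow (hd : IsDivision N h) (j : ℕ) : IsDivision (N ^ j) (h ^ j) := by
  induction j with
  | zero => exact ⟨fun x => by simp, fun x => by simp⟩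
  | succ j ih =>
    constructor
    · intro x
      change N ^ (j + 1) • (h ^ j) (h x) = x
      rw [pow_succ, mul_comm, mul_nsmul',
        ih.nsmul_apply, hd.nsmul_apply]
    · intro x
      change (h ^ j) (h (N ^ (j + 1) • x)) = x
      rw [pow_succ, mul_nsmul, hd.apply_nsmul, ih.apply_nsmul]

omit [Module ℝ π.ker] in
theorem map_eq (hd : IsDivision N h) (hN : N ≠ 0) (x : X) : π (h x) = (N : ℝ)⁻¹ • π x := by
  have hN' : (N : ℝ) ≠ 0 := by exact_mod_cast hN
  conv_rhs => rw [← hd.nsmul_apply x, map_nsmul, ← Nat.cast_smul_eq_nsmul ℝ, inv_smul_smul₀ hN']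

omit [Module ℝ Z] in
theorem coe_eq (hd : IsDivision N h) (hN : N ≠ 0) (y : π.ker) :
    h (y : X) = ((N : ℝ)⁻¹ • y : π.ker) := by
  have hN' : (N : ℝ) ≠ 0 := by exact_mod_cast hN
  have h1 : y = N • ((N : ℝ)⁻¹ • y) := by rw [← Nat.cast_smul_eq_nsmul ℝ, smul_inv_smul₀ hN']
  conv_lhs => rw [h1]
  rw [AddSubgroup.coe_nsmul, hd.apply_nsmul]

omit [Module ℝ π.ker] in
theorem map_zsmul_pow (hd : IsDivision N h) (hN : N ≠ 0) (k : ℤ) (j : ℕ) (x : X) :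
    π (k • (h ^ j) x) = ((k : ℝ) / (N : ℝ) ^ j) • π x := by
  rw [map_zsmul, (hd.pow j).map_eq (pow_ne_zero _ hN), ← Int.cast_smul_eq_zsmul ℝ, smul_smul,
    Nat.cast_pow, div_eq_mul_inv]

omit [Module ℝ Z] in
theorem coe_zsmul_pow (hd : IsDivision N h) (hN : N ≠ 0) (k : ℤ) (j : ℕ) (y : π.ker) :
    k • (h ^ j) (y : X) = (((k : ℝ) / (N : ℝ) ^ j) • y : π.ker) := by
  rw [(hd.pow j).coe_eq (pow_ne_zero _ hN), ← AddSubgroup.coe_zsmul,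
    ← Int.cast_smul_eq_zsmul ℝ, smul_smul, Nat.cast_pow, div_eq_mul_inv]

end IsDivision

/-! ### Stable neighbourhoods in the kernel -/

/-- The neighbourhoods of `0` in `Y` can be chosen stable under a perturbed division by `N`. -/
def HasStableNhds (Y : Type*) [AddCommGroup Y] [Module ℝ Y] [TopologicalSpace Y] (N : ℕ) : Prop :=
  ∀ O ∈ 𝓝 (0 : Y), ∃ K ∈ 𝓝 (0 : Y), K ⊆ O ∧ ∃ K' ∈ 𝓝 (0 : Y),
    ∀ a ∈ K, ∀ b ∈ K', (N : ℝ)⁻¹ • a + b ∈ K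

/-- For convex `K`, the point `a/2 + b` is the midpoint of `a` and `2b`. -/
theorem hasStableNhds_of_locallyConvex {Y : Type*} [AddCommGroup Y] [Module ℝ Y]
    [TopologicalSpace Y] [IsTopologicalAddGroup Y] [ContinuousSMul ℝ Y] [LocallyConvexSpace ℝ Y] :
    HasStableNhds Y 2 := by
  intro O hO
  obtain ⟨K, ⟨hK, hKc⟩, hKO⟩ := (LocallyConvexSpace.convex_basis_zero ℝ Y).mem_iff.1 hO
  refine ⟨K, hK, hKO, {b | (2 : ℝ) • b ∈ K}, ?_, ?_⟩
  · exact (continuous_const_smul (2 : ℝ)).continuousAt.preimage_mem_nhds (by simpa using hK)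
  · intro a ha b hb
    have h1 := hKc ha hb (a := (2 : ℝ)⁻¹) (b := (2 : ℝ)⁻¹) (by norm_num) (by norm_num)
      (by norm_num)
    simpa [smul_smul] using h1

/-- With `B` bounded and `C + C ⊆ B`, choose `N` with `N⁻¹B ⊆ C`. Then `N⁻¹B + C ⊆ B`, and the
multiples `n⁻¹B`, `n⁻¹C` inherit this relation. -/
theorem exists_hasStableNhds_of_bounded {Y : Type*} [AddCommGroup Y] [Module ℝ Y]
    [TopologicalSpace Y] [IsTopologicalAddGroup Y] [ContinuousSMul ℝ Y]
    (hY : ∃ U ∈ 𝓝 (0 : Y), Bornology.IsVonNBounded ℝ U) :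
    ∃ N : ℕ, 2 ≤ N ∧ HasStableNhds Y N := by
  obtain ⟨B, hB, hBb⟩ := hY
  have h0 : ∀ᶠ p : Y × Y in 𝓝 0 ×ˢ 𝓝 0, p.1 + p.2 ∈ B := by
    have : Filter.Tendsto (fun p : Y × Y => p.1 + p.2) (𝓝 (0, 0)) (𝓝 0) := by
      simpa using (continuous_add (M := Y)).tendsto (0, 0)
    rw [nhds_prod_eq] at this
    exact this hB
  obtain ⟨C, hC, hCB⟩ := Filter.eventually_prod_self_iff (r := fun x y : Y => x + y ∈ B) |>.1 h0
  have hsm : ∀ O ∈ 𝓝 (0 : Y), ∀ᶠ n : ℕ in Filter.atTop, ∀ b ∈ B, ((n : ℝ)⁻¹) • b ∈ O := by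
    intro O hO
    have := (hBb hO).eventually_nhds_zero (mem_of_mem_nhds hO)
    have h2 := (tendsto_inv_atTop_nhds_zero_nat (𝕜 := ℝ)).eventually this
    filter_upwards [h2] with n hn b hb using hn hb
  obtain ⟨N, hN, hN2⟩ := ((hsm C hC).and (Filter.eventually_ge_atTop 2)).exists
  refine ⟨N, hN2, fun O hO => ?_⟩
  obtain ⟨n, hn, hn1⟩ := ((hsm O hO).and (Filter.eventually_ge_atTop 1)).exists
  have hn0 : (n : ℝ) ≠ 0 := by positivity
  have hN0 : (N : ℝ) ≠ 0 := by positivity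
  refine ⟨{y | (n : ℝ) • y ∈ B}, ?_, ?_, {y | (n : ℝ) • y ∈ C}, ?_, ?_⟩
  · exact (continuous_const_smul (n : ℝ)).continuousAt.preimage_mem_nhds (by simpa using hB)
  · intro y hy
    simpa [smul_smul, inv_mul_cancel₀ hn0] using hn _ hy
  · exact (continuous_const_smul (n : ℝ)).continuousAt.preimage_mem_nhds (by simpa using hC)
  · intro a ha b hb
    have := hCB _ (hN _ ha) _ hb
    simp only [Set.mem_ofPred_eq, smul_add]
    rwa [smul_comm]

/-! ### Lifts with small fractions -/

/-- Small elements of `Z` have lifts all of whose `N`-adic fractions are small. -/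
theorem exists_small_lift {X Z : Type*}
    [AddCommGroup X] [TopologicalSpace X] [IsTopologicalAddGroup X]
    [AddCommGroup Z] [Module ℝ Z] [TopologicalSpace Z] [ContinuousSMul ℝ Z]
    {π : X →+ Z} (hopen : IsOpenMap π) [Module ℝ π.ker] [ContinuousSMul ℝ π.ker]
    {N : ℕ} (hN : N ≠ 0) (hst : HasStableNhds π.ker N) {h : AddMonoid.End X}
    (hd : IsDivision N h) {W : Set X} (hW : W ∈ 𝓝 0) :
    ∃ V ∈ 𝓝 (0 : Z), ∀ z ∈ V, ∃ x, π x = z ∧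
      ∀ (j : ℕ) (k : ℤ), |k| ≤ N ^ j → k • (h ^ j) x ∈ W := by
  have hN' : (N : ℝ) ≠ 0 := by exact_mod_cast hN
  obtain ⟨W₀, hW₀, hW₀n, hW₀W⟩ : ∃ W₀ ∈ 𝓝 (0 : X), (∀ x ∈ W₀, -x ∈ W) ∧ W₀ ⊆ W := by
    refine ⟨W ∩ -W, Filter.inter_mem hW (neg_mem_nhds_zero _ hW), fun x hx => hx.2,
      Set.inter_subset_left⟩
  obtain ⟨W₁, hW₁, hW₁W⟩ := exists_nhds_zero_half hW₀
  obtain ⟨K, hK, hKO, K', hK', hKK⟩ := hst (Subtype.val ⁻¹' W₁)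
    (continuous_subtype_val.continuousAt.preimage_mem_nhds (by simpa using hW₁))
  have hNK' : {y : π.ker | (N : ℝ)⁻¹ • y ∈ K'} ∈ 𝓝 (0 : π.ker) :=
    (continuous_const_smul (N : ℝ)⁻¹).continuousAt.preimage_mem_nhds (by simpa using hK')
  obtain ⟨E, hE, hEK⟩ := mem_nhds_subtype _ _ _ |>.1 hNK'
  -- The expression is the linearity defect of the section `σ` below; only finitely many digits `d`
  -- occur, so one neighbourhood serves all.
  have hev : ∀ d ∈ Finset.range (N + 1), ∀ᶠ p : X × X × X in 𝓝 0,
      p.1 + d • p.2.1 - N • p.2.2 ∈ E := by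
    intro d _
    have hc : Continuous (fun p : X × X × X => p.1 + d • p.2.1 - N • p.2.2) := by fun_prop
    exact hc.continuousAt.preimage_mem_nhds (by simpa using hE)
  have hev' := (Filter.eventually_all_finset _).2 hev
  rw [show (0 : X × X × X) = (0, 0, 0) from rfl, nhds_prod_eq, nhds_prod_eq] at hev'
  obtain ⟨U₁, hU₁, U₂, hU₂, hU⟩ := Filter.mem_prod_iff.1 hev'
  obtain ⟨U₃, hU₃, U₄, hU₄, hU'⟩ := Filter.mem_prod_iff.1 hU₂
  have hU₀ : U₁ ∩ U₃ ∩ U₄ ∩ W₁ ∈ 𝓝 (0 : X) :=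
    Filter.inter_mem (Filter.inter_mem (Filter.inter_mem hU₁ hU₃) hU₄) hW₁
  obtain ⟨V, ⟨hV, hVb⟩, hVU⟩ := (nhds_basis_balanced ℝ Z).mem_iff.1
    (by simpa using hopen.image_mem_nhds hU₀ : π '' (U₁ ∩ U₃ ∩ U₄ ∩ W₁) ∈ 𝓝 (0 : Z))
  -- A section on `V`, normalised by `σ 0 = 0` for the case `k = 0` of the induction.
  have hlift : ∀ z : Z, ∃ x : X, z ∈ V → x ∈ U₁ ∩ U₃ ∩ U₄ ∩ W₁ ∧ π x = z ∧ (z = 0 → x = 0) := by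
    intro z
    by_cases hz : z ∈ V
    · by_cases hz0 : z = 0
      · exact ⟨0, fun _ => ⟨mem_of_mem_nhds hU₀, by rw [hz0, map_zero], fun _ => rfl⟩⟩
      · obtain ⟨x, hx, hxz⟩ := hVU hz
        exact ⟨x, fun _ => ⟨hx, hxz, fun h => absurd h hz0⟩⟩
    · exact ⟨0, fun h => absurd h hz⟩
  choose σ hσ using hlift
  have hmem : ∀ z ∈ V, ∀ j k : ℕ, k ≤ N ^ j → ((k : ℝ) / (N : ℝ) ^ j) • z ∈ V := by
    intro z hz j k hk
    refine hVb.smul_mem ?_ hz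
    rw [Real.norm_of_nonneg (by positivity)]
    refine div_le_one_of_le₀ (by exact_mod_cast hk) (by positivity)
  have key : ∀ z ∈ V, ∀ j k : ℕ, k ≤ N ^ j →
      ∃ y ∈ K, k • (h ^ j) (σ z) = σ (((k : ℝ) / (N : ℝ) ^ j) • z) + (y : X) := by
    intro z hz j
    induction j with
    | zero =>
      intro k hk
      refine ⟨0, mem_of_mem_nhds hK, ?_⟩
      have hk1 : k ≤ 1 := by simpa using hk
      interval_cases k
      · have h0V : (0 : Z) ∈ V := mem_of_mem_nhds hV
        simp [(hσ 0 h0V).2.2 rfl]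
      · simp
    | succ j ih =>
      intro k hk
      have hNj : 0 < N ^ j := pow_pos (Nat.pos_of_ne_zero hN) j
      -- The leading digit may equal `N`, namely for `k = N ^ (j + 1)`. The new error is `N⁻¹` times
      -- the old one plus `N⁻¹` times the defect of `σ`, hence again in `K`.
      obtain ⟨m, d, hm, hdN, rfl⟩ : ∃ m d : ℕ, m ≤ N ^ j ∧ d ≤ N ∧ k = m + d * N ^ j := by
        refine ⟨k % N ^ j, k / N ^ j, (Nat.mod_lt _ hNj).le, ?_, ?_⟩
        · exact Nat.div_le_of_le_mul (by rwa [pow_succ] at hk)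
        · rw [mul_comm, Nat.mod_add_div]
      obtain ⟨y, hy, hyσ⟩ := ih m hm
      set z₁ := ((m : ℝ) / (N : ℝ) ^ j) • z with hz₁
      set z₂ := (((m + d * N ^ j : ℕ) : ℝ) / (N : ℝ) ^ (j + 1)) • z with hz₂
      have hz₁V : z₁ ∈ V := hmem z hz j m hm
      have hz₂V : z₂ ∈ V := hmem z hz (j + 1) _ hk
      have hπ : π (σ z₁ + d • σ z - N • σ z₂) = 0 := by
        rw [map_sub, map_add, map_nsmul, map_nsmul, (hσ _ hz₁V).2.1, (hσ _ hz₂V).2.1,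
          (hσ _ hz).2.1, ← Nat.cast_smul_eq_nsmul ℝ, ← Nat.cast_smul_eq_nsmul ℝ, hz₁, hz₂,
          smul_smul, ← add_smul, ← sub_smul]
        convert zero_smul ℝ z
        push_cast
        field_simp
        ring
      have he : (N : ℝ)⁻¹ • (⟨_, hπ⟩ : π.ker) ∈ K' := by
        apply hEK
        have h1 : (σ z₁, σ z, σ z₂) ∈ U₁ ×ˢ U₂ :=
          ⟨(hσ _ hz₁V).1.1.1.1, hU' ⟨(hσ _ hz).1.1.1.2, (hσ _ hz₂V).1.1.2⟩⟩
        exact hU h1 d (Finset.mem_range.2 (by omega))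
      refine ⟨_, hKK y hy _ he, ?_⟩
      have h1 : (m + d * N ^ j) • (h ^ (j + 1)) (σ z) = h (m • (h ^ j) (σ z) + d • σ z) := by
        rw [add_nsmul, mul_nsmul', map_add, map_nsmul, map_nsmul, pow_succ']
        change m • h ((h ^ j) (σ z)) + d • (N ^ j • h ((h ^ j) (σ z))) = _
        rw [← map_nsmul h (N ^ j), (hd.pow j).nsmul_apply]
      have h2 : m • (h ^ j) (σ z) + d • σ z =
          N • σ z₂ + ((y : X) + ((⟨_, hπ⟩ : π.ker) : X)) := by
        rw [hyσ]
        simp only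
        abel
      rw [h1, h2, map_add, hd.apply_nsmul, map_add, hd.coe_eq hN, hd.coe_eq hN,
        ← AddSubgroup.coe_add]
  refine ⟨V, hV, fun z hz => ⟨σ z, (hσ z hz).2.1, fun j k hk => ?_⟩⟩
  have hnat : ∀ k : ℕ, k ≤ N ^ j → k • (h ^ j) (σ z) ∈ W₀ := by
    intro k hk
    obtain ⟨y, hy, hyσ⟩ := key z hz j k hk
    rw [hyσ]
    exact hW₁W _ (hσ _ (hmem z hz j k hk)).1.2 _ (hKO hy)
  have hk' := hnat k.natAbs (by zify; exact hk)
  rcases Int.natAbs_eq k with hk1 | hk1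
  · rw [hk1, natCast_zsmul]
    exact hW₀W hk'
  · rw [hk1, neg_smul, natCast_zsmul]
    exact hW₀n _ hk'

/-! ### Convergence from completeness of the kernel -/

open Filter in
/-- Cauchy sequences converge in an extension by a complete group, as soon as their images do. -/
theorem exists_tendsto_of_isCompleteAddGroup_ker {X Z : Type*}
    [AddCommGroup X] [TopologicalSpace X] [IsTopologicalAddGroup X]
    [AddCommGroup Z] [TopologicalSpace Z] [IsTopologicalAddGroup Z]
    {π : X →+ Z} (hopen : IsOpenMap π) (hsurj : Function.Surjective π)
    (hY : IsCompleteAddGroup π.ker) {a : ℕ → X}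
    (ha : ∀ W ∈ 𝓝 (0 : X), ∃ i, ∀ j ≥ i, a j - a i ∈ W) {z : Z}
    (hz : Tendsto (fun j => π (a j)) atTop (𝓝 z)) : ∃ x, Tendsto a atTop (𝓝 x) := by
  let _ := IsTopologicalAddGroup.rightUniformSpace π.ker
  have : IsUniformAddGroup π.ker := isUniformAddGroup_of_addCommGroup
  have : CompleteSpace π.ker := hY
  obtain ⟨x₀, rfl⟩ := hsurj z
  have hquart : ∀ E ∈ 𝓝 (0 : X), ∃ W ∈ 𝓝 (0 : X), ∀ b ∈ W, ∀ c ∈ W, ∀ d ∈ W, ∀ e ∈ W,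
      b - c + d - e ∈ E ∧ b - c + d + e ∈ E := by
    intro E hE
    obtain ⟨W, hW, hWE⟩ := exists_nhds_zero_quarter hE
    refine ⟨W ∩ -W, inter_mem hW (neg_mem_nhds_zero _ hW), fun b hb c hc d hd e he => ⟨?_, ?_⟩⟩
    · rw [sub_eq_add_neg, sub_eq_add_neg b c]
      exact hWE hb.1 hc.2 hd.1 he.2
    · rw [sub_eq_add_neg b c]
      exact hWE hb.1 hc.2 hd.1 he.1
  -- Pairs `(j, y)` with `j` large and `y` in the kernel close to `a j - x₀`; the second components
  -- form a Cauchy filter.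
  let G : Filter (ℕ × π.ker) := comap Prod.fst atTop ⊓
    comap (fun p : ℕ × π.ker => a p.1 - x₀ - (p.2 : X)) (𝓝 0)
  have hGmem : ∀ (i : ℕ) (W : Set X), W ∈ 𝓝 0 →
      {p : ℕ × π.ker | i ≤ p.1 ∧ a p.1 - x₀ - (p.2 : X) ∈ W} ∈ G := fun i W hW =>
    inter_mem_inf (preimage_mem_comap (Ici_mem_atTop i)) (preimage_mem_comap hW)
  have hGne : NeBot G := by
    refine inf_neBot_iff.2 ?_
    intro s hs s' hs'
    obtain ⟨t, ht, hts⟩ := mem_comap.1 hs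
    obtain ⟨W, hW, hWs⟩ := mem_comap.1 hs'
    have h1 : ∀ᶠ j in atTop, π (a j) - π x₀ ∈ π '' W := by
      have h2 : Tendsto (fun j => π (a j) - π x₀) atTop (𝓝 0) := by
        simpa using hz.sub_const (π x₀)
      exact h2 (by simpa using hopen.image_mem_nhds hW)
    obtain ⟨j, ⟨w, hw, hwj⟩, hjt⟩ := (h1.and ht).exists
    have h3 : π (a j - x₀ - w) = 0 := by rw [map_sub, map_sub, hwj, sub_self]
    refine ⟨(j, ⟨_, h3⟩), hts hjt, hWs ?_⟩
    simpa using hw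
  have hC : Cauchy (map Prod.snd G) := by
    refine cauchy_iff.2 ⟨inferInstance, fun s hs => ?_⟩
    rw [uniformity_eq_comap_nhds_zero, mem_comap] at hs
    obtain ⟨O, hO, hOs⟩ := hs
    obtain ⟨E, hE, hEO⟩ := (mem_nhds_subtype _ _ _).1 hO
    obtain ⟨W, hW, hWE⟩ := hquart E hE
    obtain ⟨i, hi⟩ := ha W hW
    refine ⟨_, image_mem_map (hGmem i W hW), ?_⟩
    rintro ⟨_, _⟩ ⟨⟨⟨j, y⟩, ⟨hj, hy⟩, rfl⟩, ⟨⟨j', y'⟩, ⟨hj', hy'⟩, rfl⟩⟩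
    apply hOs
    apply hEO
    change (y' : X) - y ∈ E
    -- `y' - y` is the difference of the two approximation errors plus `(a j' - a i) - (a j - a i)`.
    have := (hWE _ hy _ hy' _ (hi _ hj') _ (hi _ hj)).1
    convert this using 1
    simp only
    abel
  obtain ⟨y, hy⟩ := CompleteSpace.complete hC
  refine ⟨x₀ + y, ?_⟩
  rw [← tendsto_sub_nhds_zero_iff]
  refine tendsto_def.2 fun E hE => ?_
  obtain ⟨W, hW, hWE⟩ := hquart E hE
  obtain ⟨i, hi⟩ := ha W hW
  have h1 : {y' : π.ker | (y' : X) - y ∈ W} ∈ 𝓝 y := by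
    have hc : Continuous (fun y' : π.ker => (y' : X) - y) := by fun_prop
    exact hc.continuousAt.preimage_mem_nhds (by simpa using hW)
  obtain ⟨⟨j', y'⟩, hy', hj', hjW⟩ :=
    nonempty_of_mem (inter_mem (mem_map.1 (hy h1)) (hGmem i W hW))
  filter_upwards [eventually_ge_atTop i] with j hj
  have := (hWE _ (hi j hj) _ (hi j' hj') _ hjW _ hy').2
  change a j - (x₀ + y) ∈ E
  convert this using 1
  abel

/-! ### One-parameter subgroups -/

theorem abs_floor_pow_mul_le {N : ℕ} (hN : N ≠ 0) {i j : ℕ} (hij : i ≤ j) {t : ℝ}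
    (ht : |t| * (N : ℝ) ^ i ≤ 1) : |⌊(N : ℝ) ^ j * t⌋| * (N : ℤ) ^ i ≤ (N : ℤ) ^ j := by
  obtain ⟨l, rfl⟩ := Nat.exists_eq_add_of_le hij
  have hN' : (0 : ℝ) < N := by positivity
  rw [pow_add (N : ℤ), mul_comm]
  refine mul_le_mul_of_nonneg_left ?_ (by positivity)
  have h1 : |(N : ℝ) ^ (i + l) * t| ≤ (N : ℝ) ^ l := by
    rw [abs_mul, abs_of_nonneg (by positivity), pow_add]
    calc (N : ℝ) ^ i * (N : ℝ) ^ l * |t| = (N : ℝ) ^ l * (|t| * (N : ℝ) ^ i) := by ring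
      _ ≤ (N : ℝ) ^ l * 1 := by gcongr
      _ = _ := mul_one _
  rw [abs_le] at h1 ⊢
  constructor
  · rw [Int.le_floor]
    push_cast
    exact h1.1
  · have := (Int.floor_le ((N : ℝ) ^ (i + l) * t)).trans h1.2
    exact_mod_cast this

theorem tendsto_floor_pow_mul_div {N : ℕ} (hN : 2 ≤ N) (t : ℝ) :
    Filter.Tendsto (fun j : ℕ => (⌊(N : ℝ) ^ j * t⌋ : ℝ) / (N : ℝ) ^ j) Filter.atTop (𝓝 t) := by
  have hN1 : (1 : ℝ) < N := by exact_mod_cast hN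
  have h1 : Filter.Tendsto (fun j : ℕ => ((N : ℝ) ^ j)⁻¹) Filter.atTop (𝓝 0) :=
    (tendsto_pow_atTop_atTop_of_one_lt hN1).inv_tendsto_atTop
  rw [← tendsto_sub_nhds_zero_iff]
  refine squeeze_zero_norm (fun j => ?_) h1
  have hpos : (0 : ℝ) < (N : ℝ) ^ j := by positivity
  have h2 : (⌊(N : ℝ) ^ j * t⌋ : ℝ) / (N : ℝ) ^ j - t =
      (⌊(N : ℝ) ^ j * t⌋ - (N : ℝ) ^ j * t) * ((N : ℝ) ^ j)⁻¹ := by field_simp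
  rw [h2, Real.norm_eq_abs, abs_mul, abs_of_pos (inv_pos.2 hpos)]
  refine mul_le_of_le_one_left (by positivity) ?_
  rw [abs_le]
  constructor <;> linarith [Int.floor_le ((N : ℝ) ^ j * t), Int.lt_floor_add_one ((N : ℝ) ^ j * t)]

section OneParameter

variable {X Z : Type*} [AddCommGroup X] [TopologicalSpace X] [IsTopologicalAddGroup X]
  [AddCommGroup Z] [Module ℝ Z] [TopologicalSpace Z] [ContinuousSMul ℝ Z]
  {π : X →+ Z} [Module ℝ π.ker] [ContinuousSMul ℝ π.ker]

/-- Small `N`-adic fractions of a given element are small. -/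
theorem exists_pow_small (hopen : IsOpenMap π) {N : ℕ} (hN : 2 ≤ N) (hst : HasStableNhds π.ker N)
    {h : AddMonoid.End X} (hd : IsDivision N h) (x : X) {W : Set X} (hW : W ∈ 𝓝 0) :
    ∃ i : ℕ, ∀ (j : ℕ) (k : ℤ), |k| * (N : ℤ) ^ i ≤ (N : ℤ) ^ j → k • (h ^ j) x ∈ W := by
  have hN0 : N ≠ 0 := by omega
  have hN1 : (1 : ℝ) < N := by exact_mod_cast hN
  obtain ⟨W₁, hW₁, hWW⟩ := exists_nhds_zero_half hW
  obtain ⟨V, hV, hVl⟩ := exists_small_lift hopen hN0 hst hd hW₁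
  have hpow : Filter.Tendsto (fun j : ℕ => ((N : ℝ) ^ j)⁻¹) Filter.atTop (𝓝 0) :=
    (tendsto_pow_atTop_atTop_of_one_lt hN1).inv_tendsto_atTop
  -- Write `N⁻ⁿ x = y + x'` with `x'` a good lift and `y` in the kernel, where scalar multiplication
  -- is already continuous.
  obtain ⟨n, hn⟩ : ∃ n : ℕ, π ((h ^ n) x) ∈ V := by
    have h1 : Filter.Tendsto (fun j : ℕ => ((N : ℝ) ^ j)⁻¹ • π x) Filter.atTop (𝓝 0) := by
      simpa using hpow.smul_const (π x)
    obtain ⟨n, hn⟩ := (h1.eventually hV).exists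
    refine ⟨n, ?_⟩
    rwa [(hd.pow n).map_eq (pow_ne_zero _ hN0), Nat.cast_pow]
  obtain ⟨x', hx', hx'W⟩ := hVl _ hn
  have hy : π ((h ^ n) x - x') = 0 := by rw [map_sub, hx', sub_self]
  set y : π.ker := ⟨_, hy⟩ with hydef
  obtain ⟨ε, hε, hεW⟩ : ∃ ε > 0, ∀ q : ℝ, |q| < ε → ((q • y : π.ker) : X) ∈ W₁ := by
    have hc : Continuous (fun q : ℝ => ((q • y : π.ker) : X)) := by fun_prop
    have h1 : (fun q : ℝ => ((q • y : π.ker) : X)) ⁻¹' W₁ ∈ 𝓝 (0 : ℝ) :=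
      hc.continuousAt.preimage_mem_nhds (by simpa using hW₁)
    obtain ⟨ε, hε, hb⟩ := Metric.mem_nhds_iff.1 h1
    exact ⟨ε, hε, fun q hq => hb (by simpa using hq)⟩
  obtain ⟨m, hm⟩ := (hpow.eventually (gt_mem_nhds hε)).exists
  refine ⟨n + m, fun j k hk => ?_⟩
  by_cases hk0 : k = 0
  · simpa [hk0] using mem_of_mem_nhds hW
  have hk1 : 1 ≤ |k| := Int.one_le_abs hk0
  have hNp : ∀ i, (0 : ℤ) < (N : ℤ) ^ i := fun i => by positivity
  -- A nonzero `k` has `|k| ≥ 1`, so the bound on `k` forces `j` to be large.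
  have hj : n + m ≤ j := by
    have h1 : (N : ℤ) ^ (n + m) ≤ (N : ℤ) ^ j := by nlinarith [hNp (n + m)]
    exact (pow_le_pow_iff_right₀ (by exact_mod_cast hN : (1 : ℤ) < N)).1 h1
  obtain ⟨l, rfl⟩ := Nat.exists_eq_add_of_le (show n ≤ j by omega)
  have hk2 : |k| * (N : ℤ) ^ m ≤ (N : ℤ) ^ l := by
    rw [pow_add, pow_add, mul_left_comm] at hk
    exact le_of_mul_le_mul_left hk (hNp n)
  have h1 : k • (h ^ (n + l)) x = ((((k : ℝ) / (N : ℝ) ^ l) • y : π.ker) : X) + k • (h ^ l) x' := by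
    rw [← hd.coe_zsmul_pow hN0, ← zsmul_add, ← map_add, add_comm n l, pow_add]
    change k • (h ^ l) ((h ^ n) x) = _
    congr 2
    simp [hydef]
  rw [h1]
  refine hWW _ (hεW _ (lt_of_le_of_lt ?_ hm)) _ (hx'W l k ?_)
  · have hk3 : |(k : ℝ)| * (N : ℝ) ^ m ≤ (N : ℝ) ^ l := by exact_mod_cast hk2
    rw [abs_div, abs_of_pos (by positivity : (0 : ℝ) < (N : ℝ) ^ l), inv_eq_one_div,
      div_le_div_iff₀ (by positivity) (by positivity), one_mul]
    exact hk3
  · nlinarith [hNp m, abs_nonneg k]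

/-- Every element of the extension lies on a one-parameter subgroup over a line. -/
theorem exists_oneParameter [T2Space X] [T2Space Z] [IsTopologicalAddGroup Z]
    (hcont : Continuous π) (hopen : IsOpenMap π)
    (hsurj : Function.Surjective π) (hY : IsCompleteAddGroup π.ker) {N : ℕ} (hN : 2 ≤ N)
    (hst : HasStableNhds π.ker N) {h : AddMonoid.End X} (hd : IsDivision N h) (x : X) :
    ∃ γ : ℝ →+ X, Continuous γ ∧ γ 1 = x ∧ (∀ t, π (γ t) = t • π x) ∧
      ∀ W : Set X, IsClosed W → (∀ (j : ℕ) (k : ℤ), |k| ≤ N ^ j → k • (h ^ j) x ∈ W) →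
        ∀ t, |t| ≤ 1 → γ t ∈ W := by
  have hN0 : N ≠ 0 := by omega
  have hN1 : (1 : ℝ) < N := by exact_mod_cast hN
  have hsmall := fun (W : Set X) (hW : W ∈ 𝓝 0) => exists_pow_small hopen hN hst hd x hW
  have hπ : ∀ t : ℝ, Filter.Tendsto (fun j : ℕ => π (⌊(N : ℝ) ^ j * t⌋ • (h ^ j) x)) Filter.atTop
      (𝓝 (t • π x)) := by
    intro t
    simp only [hd.map_zsmul_pow hN0]
    exact (tendsto_floor_pow_mul_div hN t).smul_const _
  have hlim : ∀ t : ℝ, ∃ g, Filter.Tendsto (fun j : ℕ => ⌊(N : ℝ) ^ j * t⌋ • (h ^ j) x)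
      Filter.atTop (𝓝 g) := by
    intro t
    refine exists_tendsto_of_isCompleteAddGroup_ker hopen hsurj hY (fun W hW => ?_) (hπ t)
    obtain ⟨i, hi⟩ := hsmall W hW
    refine ⟨i, fun j hj => ?_⟩
    obtain ⟨l, rfl⟩ := Nat.exists_eq_add_of_le hj
    have h1 : (h ^ i) x = N ^ l • (h ^ (i + l)) x := by
      rw [add_comm, pow_add]
      exact ((hd.pow l).nsmul_apply _).symm
    have h2 : ⌊(N : ℝ) ^ (i + l) * t⌋ • (h ^ (i + l)) x - ⌊(N : ℝ) ^ i * t⌋ • (h ^ i) x =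
        (⌊(N : ℝ) ^ (i + l) * t⌋ - ⌊(N : ℝ) ^ i * t⌋ * (N : ℤ) ^ l) • (h ^ (i + l)) x := by
      rw [h1, sub_smul, mul_smul, ← natCast_zsmul _ (N ^ l), Nat.cast_pow]
    rw [h2]
    apply hi
    have hl : (0 : ℝ) < (N : ℝ) ^ l := by positivity
    have hf1 := Int.floor_le ((N : ℝ) ^ i * t)
    have hf2 := Int.lt_floor_add_one ((N : ℝ) ^ i * t)
    -- Refining the `N`-adic approximation from level `i` to level `i + l` changes the coefficient
    -- by at most `N ^ l`.
    have h3 : ⌊(N : ℝ) ^ i * t⌋ * (N : ℤ) ^ l ≤ ⌊(N : ℝ) ^ (i + l) * t⌋ := by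
      rw [Int.le_floor]
      push_cast
      rw [pow_add]
      nlinarith
    have h4 : ⌊(N : ℝ) ^ (i + l) * t⌋ ≤ (⌊(N : ℝ) ^ i * t⌋ + 1) * (N : ℤ) ^ l := by
      have : (⌊(N : ℝ) ^ (i + l) * t⌋ : ℝ) ≤ (⌊(N : ℝ) ^ i * t⌋ + 1) * (N : ℝ) ^ l := by
        refine (Int.floor_le _).trans ?_
        rw [pow_add]
        nlinarith
      exact_mod_cast this
    rw [abs_of_nonneg (sub_nonneg.2 h3), pow_add (N : ℤ), mul_comm]
    exact mul_le_mul_of_nonneg_left (by linarith) (pow_nonneg (Int.natCast_nonneg N) i)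
  choose g hg using hlim
  -- Bounds on `N`-adic fractions pass to the limit in closed sets. This gives continuity at `0`,
  -- and with `i = 0` the last claim.
  have hgW : ∀ W : Set X, IsClosed W → ∀ i : ℕ,
      (∀ (j : ℕ) (k : ℤ), |k| * (N : ℤ) ^ i ≤ (N : ℤ) ^ j → k • (h ^ j) x ∈ W) →
      ∀ t, |t| * (N : ℝ) ^ i ≤ 1 → g t ∈ W := by
    intro W hW i hi t ht
    refine hW.mem_of_tendsto (hg t) ?_
    filter_upwards [Filter.eventually_ge_atTop i] with j hj
    exact hi j _ (abs_floor_pow_mul_le hN0 hj ht)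
  have hadd : ∀ s t, g (s + t) = g s + g t := by
    intro s t
    have h1 : Filter.Tendsto (fun j : ℕ => ⌊(N : ℝ) ^ j * (s + t)⌋ • (h ^ j) x -
        (⌊(N : ℝ) ^ j * s⌋ • (h ^ j) x + ⌊(N : ℝ) ^ j * t⌋ • (h ^ j) x)) Filter.atTop (𝓝 0) := by
      refine Filter.tendsto_def.2 fun W hW => ?_
      obtain ⟨i, hi⟩ := hsmall W hW
      filter_upwards [Filter.eventually_ge_atTop i] with j hj
      rw [Set.mem_preimage, ← add_smul, ← sub_smul]
      apply hi
      -- The floor is additive up to `1`, and `N⁻ʲ x` tends to `0`.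
      have h2 : |⌊(N : ℝ) ^ j * (s + t)⌋ - (⌊(N : ℝ) ^ j * s⌋ + ⌊(N : ℝ) ^ j * t⌋)| ≤ 1 := by
        rw [mul_add, abs_le]
        have := Int.le_floor_add ((N : ℝ) ^ j * s) ((N : ℝ) ^ j * t)
        have := Int.le_floor_add_floor ((N : ℝ) ^ j * s) ((N : ℝ) ^ j * t)
        constructor <;> linarith
      calc _ ≤ 1 * (N : ℤ) ^ i := by gcongr
        _ = (N : ℤ) ^ i := one_mul _
        _ ≤ (N : ℤ) ^ j := pow_le_pow_right₀ (by omega) hj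
    have h2 := (hg (s + t)).sub ((hg s).add (hg t))
    exact sub_eq_zero.1 (tendsto_nhds_unique h2 h1)
  refine ⟨AddMonoidHom.mk' g hadd, ?_, ?_, ?_, ?_⟩
  · refine continuous_of_continuousAt_zero (AddMonoidHom.mk' g hadd) ?_
    rw [ContinuousAt, map_zero]
    refine Filter.tendsto_def.2 fun E hE => ?_
    obtain ⟨W, hW, hWc, hWE⟩ := exists_mem_nhds_isClosed_subset hE
    obtain ⟨i, hi⟩ := hsmall W hW
    have hpos : (0 : ℝ) < ((N : ℝ) ^ i)⁻¹ := by positivity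
    filter_upwards [Metric.ball_mem_nhds (0 : ℝ) hpos] with t ht
    refine hWE (hgW W hWc i hi t ?_)
    rw [mem_ball_zero_iff, Real.norm_eq_abs] at ht
    rw [← le_div_iff₀ (by positivity), one_div]
    exact ht.le
  · refine tendsto_nhds_unique (hg 1) ?_
    refine tendsto_const_nhds.congr fun j => ?_
    rw [mul_one, ← Nat.cast_pow, Int.floor_natCast, natCast_zsmul, (hd.pow j).nsmul_apply]
  · intro t
    exact tendsto_nhds_unique ((hcont.tendsto _).comp (hg t)) (hπ t)
  · intro W hWc hW t ht
    exact hgW W hWc 0 (fun j k hk => hW j k (by simpa using hk)) t (by simpa using ht)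

omit [Module ℝ Z] [ContinuousSMul ℝ Z] [TopologicalSpace Z] in
-- The difference is a continuous homomorphism from `ℝ` into the kernel, hence real-linear, and it
-- vanishes at `1`.
theorem oneParameter_ext [T2Space X] {γ₁ γ₂ : ℝ →+ X} (h₁ : Continuous γ₁) (h₂ : Continuous γ₂)
    (hπ : ∀ t, π (γ₁ t) = π (γ₂ t)) (h : γ₁ 1 = γ₂ 1) (t : ℝ) : γ₁ t = γ₂ t := by
  have hmem : ∀ t, (γ₁ - γ₂) t ∈ π.ker := fun t => by simp [AddMonoidHom.mem_ker, hπ t]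
  let δ : ℝ →+ π.ker := (γ₁ - γ₂).codRestrict π.ker hmem
  have hδ : Continuous δ := Continuous.subtype_mk (h₁.sub h₂) _
  have h1 : δ 1 = 0 := Subtype.ext (sub_eq_zero.2 h)
  have h2 : δ t = 0 := by
    have := map_real_smul δ hδ t 1
    rwa [h1, smul_zero, smul_eq_mul, mul_one] at this
  exact sub_eq_zero.1 (congrArg Subtype.val h2)

end OneParameter

/-! ### Metrizability of the extension -/

/-- First countability is a three-space property for topological groups. -/
theorem nhds_zero_isCountablyGenerated_of_ker {X Z : Type*}
    [AddCommGroup X] [TopologicalSpace X] [IsTopologicalAddGroup X]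
    [AddCommGroup Z] [TopologicalSpace Z]
    {π : X →+ Z} (hcont : Continuous π) (hopen : IsOpenMap π)
    (hY : (𝓝 (0 : π.ker)).IsCountablyGenerated) (hZ : (𝓝 (0 : Z)).IsCountablyGenerated) :
    (𝓝 (0 : X)).IsCountablyGenerated := by
  obtain ⟨O, hO⟩ := (𝓝 (0 : π.ker)).exists_antitone_basis
  have hex : ∀ n, ∃ D ∈ 𝓝 (0 : X), ∀ a ∈ D, ∀ b ∈ D, ∀ hab : a - b ∈ π.ker,
      (⟨a - b, hab⟩ : π.ker) ∈ O n := by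
    intro n
    obtain ⟨E, hE, hEO⟩ := (mem_nhds_subtype _ _ _).1 (hO.1.mem_of_mem (i := n) trivial)
    obtain ⟨D, hD, hDE⟩ := exists_nhds_half_neg (by simpa using hE)
    exact ⟨D, hD, fun a ha b hb hab => hEO (hDE a ha b hb)⟩
  choose D hD hDO using hex
  -- If `x ∈ D n` and `π x = π u` with `u ∈ U₁ ∩ D n`, then `x - u` lies in `O n`, so `x` is within
  -- `U₁ + U₁`.
  have heq : 𝓝 (0 : X) = Filter.comap π (𝓝 0) ⊓ ⨅ n, Filter.principal (D n) := by
    apply le_antisymm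
    · refine le_inf ?_ (le_iInf fun n => Filter.le_principal_iff.2 (hD n))
      rw [← Filter.tendsto_iff_comap]
      simpa using hcont.tendsto 0
    · intro U hU
      obtain ⟨U₁, hU₁, hUU⟩ := exists_nhds_zero_half hU
      obtain ⟨n, -, hn⟩ := hO.1.mem_iff.1
        (continuous_subtype_val.continuousAt.preimage_mem_nhds
          (by simpa using hU₁) : (Subtype.val ⁻¹' U₁ : Set π.ker) ∈ 𝓝 0)
      have hV : π '' (U₁ ∩ D n) ∈ 𝓝 (0 : Z) := by
        simpa using hopen.image_mem_nhds (Filter.inter_mem hU₁ (hD n))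
      refine Filter.mem_of_superset (Filter.inter_mem_inf (Filter.preimage_mem_comap hV)
        (Filter.mem_iInf_of_mem n (Filter.mem_principal_self _))) ?_
      rintro x ⟨⟨u, ⟨hu, huD⟩, hux⟩, hxD⟩
      have hk : x - u ∈ π.ker := by rw [AddMonoidHom.mem_ker, map_sub, hux, sub_self]
      have := hUU _ (hn (hDO n x hxD u huD hk)) _ hu
      simpa using this
  rw [heq]
  infer_instance

theorem metrizableSpace_of_nhds_zero {X : Type*} [AddCommGroup X] [TopologicalSpace X]
    [IsTopologicalAddGroup X] [T2Space X] (hX : (𝓝 (0 : X)).IsCountablyGenerated) :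
    TopologicalSpace.MetrizableSpace X := by
  let _ := IsTopologicalAddGroup.rightUniformSpace X
  have : IsUniformAddGroup X := isUniformAddGroup_of_addCommGroup
  have := IsUniformAddGroup.uniformity_countably_generated (α := X)
  exact UniformSpace.metrizableSpace

/-! ### The scalar multiplication on the extension -/

/-- An extension by a complete space with stable neighbourhoods carries a compatible structure of
a topological vector space. -/
theorem exists_compatible_module {X Z : Type*}
    [AddCommGroup X] [TopologicalSpace X] [IsTopologicalAddGroup X] [T2Space X]
    [AddCommGroup Z] [Module ℝ Z] [TopologicalSpace Z] (hZ : IsTVS Z)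
    (π : X →+ Z) (hcont : Continuous π) (hopen : IsOpenMap π) (hsurj : Function.Surjective π)
    [Module ℝ π.ker] (hker : IsTVS π.ker) (hY : IsCompleteAddGroup π.ker) {N : ℕ} (hN : 2 ≤ N)
    (hst : HasStableNhds π.ker N) :
    ∃ _ : Module ℝ X, IsTVS X ∧ IsCompatibleModule π := by
  have := hZ.isTopologicalAddGroup
  have := hZ.continuousSMul
  have := hZ.t2Space
  have := hker.continuousSMul
  have hN0 : N ≠ 0 := by omega
  obtain ⟨h, hd⟩ := exists_isDivision π hsurj hN0
  choose γ hγc hγ1 hγπ hγW using exists_oneParameter hcont hopen hsurj hY hN hst hd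
  have huniq : ∀ (x : X) (δ : ℝ →+ X), Continuous δ → (∀ t, π (δ t) = t • π x) → δ 1 = x →
      ∀ t, γ x t = δ t := fun x δ hδ hδπ hδ1 t =>
    oneParameter_ext (hγc x) hδ (fun s => by rw [hγπ, hδπ]) ((hγ1 x).trans hδ1.symm) t
  have hadd : ∀ x y t, γ (x + y) t = γ x t + γ y t := fun x y t =>
    huniq (x + y) (γ x + γ y) ((hγc x).add (hγc y))
      (fun s => by simp [hγπ, smul_add]) (by simp [hγ1]) t
  let M : Module ℝ X :=
    { smul := fun t x => γ x t
      one_smul := hγ1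
      mul_smul := fun s t x =>
        (huniq (γ x t) ((γ x).comp (AddMonoidHom.mulRight t))
          ((hγc x).comp (continuous_mul_const t))
          (fun r => by simp [hγπ, mul_smul]) (by simp) s).symm
      smul_zero := fun t => huniq 0 0 continuous_const (fun s => by simp) rfl t
      smul_add := fun t x y => hadd x y t
      add_smul := fun s t x => map_add (γ x) s t
      zero_smul := fun x => map_zero (γ x) }
  have hincl : ∀ (r : ℝ) (y : π.ker), ((r • y : π.ker) : X) = r • (y : X) := by
    intro r y
    refine (huniq y (π.ker.subtype.comp ((smulAddHom ℝ π.ker).flip y)) ?_ ?_ ?_ r).symm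
    · change Continuous fun t : ℝ => ((t • y : π.ker) : X)
      fun_prop
    · intro t
      have h1 : π (y : X) = 0 := y.2
      have h2 : π ((t • y : π.ker) : X) = 0 := (t • y).2
      rw [h1, smul_zero]
      exact h2
    · change ((((1 : ℝ) • y : π.ker)) : X) = y
      rw [one_smul]
  have hsmulπ : ∀ (r : ℝ) (x : X), π (r • x) = r • π x := fun r x => hγπ x r
  -- Split a small `x` as `(x - x') + x'` with `x'` a good lift of `π x`: a balanced neighbourhood
  -- in the kernel controls the first part, the closed set `W` the second.
  have hbal : ∀ U ∈ 𝓝 (0 : X), ∃ U' ∈ 𝓝 (0 : X), ∀ x ∈ U', ∀ t : ℝ, |t| ≤ 1 → t • x ∈ U := by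
    intro U hU
    obtain ⟨E, hE, hEU⟩ := exists_nhds_zero_half hU
    obtain ⟨O, ⟨hO, hOb⟩, hOE⟩ := (nhds_basis_balanced ℝ π.ker).mem_iff.1
      (continuous_subtype_val.continuousAt.preimage_mem_nhds
        (by simpa using hE) : (Subtype.val ⁻¹' E : Set π.ker) ∈ 𝓝 0)
    obtain ⟨F, hF, hFO⟩ := (mem_nhds_subtype _ _ _).1 hO
    obtain ⟨G, hG, hGF⟩ := exists_nhds_half_neg (by simpa using hF)
    obtain ⟨W, hW, hWc, hWEG⟩ := exists_mem_nhds_isClosed_subset (Filter.inter_mem hE hG)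
    obtain ⟨V, hV, hVl⟩ := exists_small_lift hopen hN0 hst hd hW
    refine ⟨G ∩ π ⁻¹' V, Filter.inter_mem hG
      (hcont.continuousAt.preimage_mem_nhds (by simpa using hV)), ?_⟩
    rintro x ⟨hxG, hxV⟩ t ht
    obtain ⟨x', hx', hx'W⟩ := hVl _ hxV
    have hsm : ∀ s : ℝ, |s| ≤ 1 → s • x' ∈ W := hγW x' W hWc hx'W
    have hk : x - x' ∈ π.ker := by rw [AddMonoidHom.mem_ker, map_sub, hx', sub_self]
    have hO' : (⟨x - x', hk⟩ : π.ker) ∈ O := by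
      apply hFO
      refine hGF x hxG x' ?_
      have := hsm 1 (by simp)
      rw [one_smul] at this
      exact (hWEG this).2
    have h1 : t • x = ((t • (⟨x - x', hk⟩ : π.ker) : π.ker) : X) + t • x' := by
      rw [hincl, ← smul_add, sub_add_cancel]
    rw [h1]
    exact hEU _ (hOE (hOb.smul_mem ht hO')) _ (hWEG (hsm t ht)).1
  refine ⟨M, ⟨inferInstance, ?_, inferInstance⟩, ⟨hincl, hsmulπ⟩⟩
  refine ContinuousSMul.of_nhds_zero ?_ ?_ ?_
  · refine Filter.tendsto_def.2 fun U hU => ?_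
    obtain ⟨U', hU', hUU⟩ := hbal U hU
    refine Filter.mem_of_superset
      (Filter.prod_mem_prod (Metric.closedBall_mem_nhds (0 : ℝ) one_pos) hU') ?_
    rintro ⟨t, x⟩ ⟨ht, hx⟩
    exact hUU x hx t (by simpa using ht)
  · intro x
    have := (hγc x).tendsto 0
    rwa [map_zero] at this
  · intro a
    -- Factor `a` as the integer `n + 1`, which acts continuously in any topological group, times a
    -- scalar of modulus at most `1`.
    obtain ⟨n, hn⟩ := exists_nat_ge |a|
    refine Filter.tendsto_def.2 fun U hU => ?_
    have hc : Continuous fun x : X => (n + 1) • x := by fun_prop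
    obtain ⟨U', hU', hUU⟩ := hbal _ (hc.continuousAt.preimage_mem_nhds (x := 0) (by simpa using hU))
    refine Filter.mem_of_superset hU' fun x hx => ?_
    have hpos : (0 : ℝ) < ((n + 1 : ℕ) : ℝ) := by positivity
    have h1 := hUU x hx (a / ((n + 1 : ℕ) : ℝ)) (by
      rw [abs_div, abs_of_pos hpos, div_le_one hpos]
      push_cast
      linarith)
    rw [Set.mem_preimage, ← Nat.cast_smul_eq_nsmul ℝ, smul_smul, mul_div_cancel₀ _ hpos.ne'] at h1
    exact h1

/-! ### Local boundedness of the extension -/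

/-- Local boundedness is a three-space property for topological vector spaces. -/
theorem exists_bounded_nhds_of_ker {X Z : Type*}
    [AddCommGroup X] [TopologicalSpace X] [IsTopologicalAddGroup X] [Module ℝ X]
    [ContinuousSMul ℝ X] [AddCommGroup Z] [Module ℝ Z] [TopologicalSpace Z]
    {π : X →+ Z} (hcont : Continuous π) (hopen : IsOpenMap π) [Module ℝ π.ker]
    (hcomp : IsCompatibleModule π)
    (hY : ∃ U ∈ 𝓝 (0 : π.ker), Bornology.IsVonNBounded ℝ U)
    (hZ : ∃ U ∈ 𝓝 (0 : Z), Bornology.IsVonNBounded ℝ U) :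
    ∃ U ∈ 𝓝 (0 : X), Bornology.IsVonNBounded ℝ U := by
  obtain ⟨B, hB, hBb⟩ := hY
  obtain ⟨C, hC, hCb⟩ := hZ
  obtain ⟨F, hF, hFB⟩ := (mem_nhds_subtype _ _ _).1 hB
  obtain ⟨G, hG, hGF⟩ := exists_nhds_half_neg (by simpa using hF)
  obtain ⟨U, ⟨hU, hUb⟩, hUG⟩ := (nhds_basis_balanced ℝ X).mem_iff.1 hG
  refine ⟨U ∩ π ⁻¹' C, Filter.inter_mem hU
    (hcont.continuousAt.preimage_mem_nhds (by simpa using hC)), fun W hW => ?_⟩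
  obtain ⟨E, hE, hEW⟩ := exists_nhds_zero_half hW
  obtain ⟨D, ⟨hD, hDb⟩, hDE⟩ := (nhds_basis_balanced ℝ X).mem_iff.1 (Filter.inter_mem hE hU)
  have hpos : ∀ {p : ℝ → Prop}, (∀ᶠ c in 𝓝 0, p c) → ∃ c, 0 < c ∧ c ≤ 1 ∧ p c := by
    intro p hp
    obtain ⟨ε, hε, hb⟩ := Metric.eventually_nhds_iff.1 hp
    refine ⟨min (ε / 2) 1, by positivity, min_le_right _ _, hb ?_⟩
    rw [Real.dist_eq, sub_zero, abs_of_pos (by positivity)]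
    exact (min_le_left _ _).trans_lt (by linarith)
  have hπD : π '' D ∈ 𝓝 (0 : Z) := by simpa using hopen.image_mem_nhds hD
  obtain ⟨l, hl0, hl1, hl⟩ := hpos ((hCb hπD).eventually_nhds_zero (mem_of_mem_nhds hπD))
  have hDY : (Subtype.val ⁻¹' D : Set π.ker) ∈ 𝓝 0 :=
    continuous_subtype_val.continuousAt.preimage_mem_nhds (by simpa using hD)
  obtain ⟨e, he0, he1, he⟩ := hpos ((hBb hDY).eventually_nhds_zero (mem_of_mem_nhds hDY))
  rw [absorbs_iff_eventually_nhds_zero (mem_of_mem_nhds hW)]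
  filter_upwards [Metric.closedBall_mem_nhds (0 : ℝ) (mul_pos he0 hl0)] with c hc
  rintro x ⟨hxU, hxC⟩
  have hcl : |c| ≤ e * l := by simpa using hc
  obtain ⟨w, hw, hwx⟩ := hl hxC
  have hk : l • x - w ∈ π.ker := by
    rw [AddMonoidHom.mem_ker, map_sub, hcomp.map_smul, hwx, sub_self]
  have hlU : l • x ∈ U := hUb.smul_mem (by rwa [Real.norm_of_nonneg hl0.le]) hxU
  have hkB : (⟨l • x - w, hk⟩ : π.ker) ∈ B := hFB (hGF _ (hUG hlU) _ (hUG (hDE hw).2))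
  have h1 : e • (l • x - w) ∈ D := by
    have := he hkB
    rwa [Set.mem_preimage, hcomp.incl_smul] at this
  -- `l` shrinks `π x` into `π '' D`, and `e` shrinks the remaining kernel part into `D`; for `|c| ≤
  -- e * l` both coefficients have modulus at most `1`.
  have h2 : c • x = (c / (e * l)) • (e • (l • x - w)) + (c / l) • w := by
    rw [smul_sub, smul_sub, smul_smul, smul_smul, smul_smul]
    have h3 : c / (e * l) * e * l = c := by field_simp
    have h4 : c / (e * l) * e = c / l := by field_simp
    rw [h3, h4, sub_add_cancel]
  change c • x ∈ W
  rw [h2]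
  refine hEW _ (hDE (hDb.smul_mem ?_ h1)).1 _ (hDE (hDb.smul_mem ?_ hw)).1
  · rw [norm_div, Real.norm_eq_abs, Real.norm_of_nonneg (by positivity)]
    exact div_le_one_of_le₀ hcl (by positivity)
  · rw [norm_div, Real.norm_eq_abs, Real.norm_of_nonneg hl0.le]
    refine div_le_one_of_le₀ (hcl.trans ?_) hl0.le
    exact mul_le_of_le_one_left hl0.le he1

theorem corollary5p5 {X Z : Type*}
    [AddCommGroup X] [TopologicalSpace X] [IsTopologicalAddGroup X] [T2Space X]
    [AddCommGroup Z] [Module ℝ Z] [TopologicalSpace Z] (hZ : IsTVS Z)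
    (π : X →+ Z) (hcont : Continuous π) (hopen : IsOpenMap π) (hsurj : Function.Surjective π)
    [Module ℝ π.ker] :
    (IsFrechetTVS π.ker → TopologicalSpace.MetrizableSpace Z →
      ∃ _ : Module ℝ X, IsTVS X ∧ IsCompatibleModule π ∧ TopologicalSpace.MetrizableSpace X) ∧
    (IsLocallyBoundedTVS π.ker → IsCompleteAddGroup π.ker → IsLocallyBoundedTVS Z →
      ∃ _ : Module ℝ X, IsTVS X ∧ IsCompatibleModule π ∧ IsLocallyBoundedTVS X) := by
  refine ⟨fun hY hZm => ?_, fun hY hYc hZb => ?_⟩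
  · have := hY.isTVS.continuousSMul
    have := hY.locallyConvex
    have := hY.metrizable
    obtain ⟨M, hX, hM⟩ := exists_compatible_module hZ π hcont hopen hsurj hY.isTVS hY.complete
      le_rfl hasStableNhds_of_locallyConvex
    exact ⟨M, hX, hM, metrizableSpace_of_nhds_zero
      (nhds_zero_isCountablyGenerated_of_ker hcont hopen inferInstance inferInstance)⟩
  · have := hY.isTVS.continuousSMul
    obtain ⟨N, hN, hst⟩ := exists_hasStableNhds_of_bounded hY.exists_bounded_nhds
    obtain ⟨M, hX, hM⟩ := exists_compatible_module hZ π hcont hopen hsurj hY.isTVS hYc hN hst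
    have := hX.continuousSMul
    exact ⟨M, hX, hM, hX, exists_bounded_nhds_of_ker hcont hopen hM hY.exists_bounded_nhds
      hZb.exists_bounded_nhds⟩
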